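/- Let $N\ge 1$ and consider a periodic chain of $N$ spins $1/2$ (Hilbert space $(\mathbb C^2)^{\otimes N}$, sites labelled by $\mathbb Z/N$), with $X_i,Y_i,Z_i$ the Pauli matrices acting on site $i$. Let $J_X,J_Y,h_X,h_Y,h_Z\in\mathbb R$ with $J_X\neq 0$ and $J_Y\neq 0$, and $$H=\sum_{i=1}^{N}\bigl(J_X X_iX_{i+1}+J_Y Y_iY_{i+1}+h_X X_i+h_Y Y_i+h_Z Z_i\bigr),\qquad \text{site } N+1 = \text{site } 1 .$$ An operator is called a $k$-support operator if it acts on $k$ consecutive sites (as the identity on all others); an operator is a $k$-support quantity if it is a sum of $l$-support operators with $l\le k$ but not a sum of $l$-support operators with $l\le k-1$; a $k$-support conserved quantity is a $k$-support quantity that commutes with $H$. If $h_X\neq 0$ or $h_Y\neq 0$, then for every integer $k$ with $3\le k\le N/2$ the Hamiltonian $H$ has no $k$-support conserved quantity. (That is, the XY model with any nonzero in-plane field component is non-integrable.) -/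

import Mathlib

namespace SpinChain

/-- Configurations of `N` two-level sites (the computational basis). Sites are labelled by
`ZMod N`, so that the site after the last one is the first one (periodic boundary condition). -/
abbrev Config (N : ℕ) : Type := ZMod N → Fin 2

/-- Operators on the Hilbert space `(ℂ²)^{⊗ N}` of the chain, in the computational basis. -/
abbrev Op (N : ℕ) : Type := Matrix (Config N) (Config N) ℂ

/-- The Pauli matrix `σˣ`. -/
def pauliX : Matrix (Fin 2) (Fin 2) ℂ := !![0, 1; 1, 0]

/-- The Pauli matrix `σʸ`. -/
def pauliY : Matrix (Fin 2) (Fin 2) ℂ := !![0, -Complex.I; Complex.I, 0]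

/-- The Pauli matrix `σᶻ`. -/
def pauliZ : Matrix (Fin 2) (Fin 2) ℂ := !![1, 0; 0, -1]

/-- The tensor product `⨂ⱼ A j` of one-site operators, as an operator on the chain. -/
def tensorOp {N : ℕ} [NeZero N] (A : ZMod N → Matrix (Fin 2) (Fin 2) ℂ) : Op N :=
  Matrix.of fun s t => ∏ j, A j (s j) (t j)

/-- The one-site operator `P` acting on site `i` (and the identity on every other site). -/
def site {N : ℕ} [NeZero N] (P : Matrix (Fin 2) (Fin 2) ℂ) (i : ZMod N) : Op N :=
  tensorOp (Function.update (fun _ => 1) i P)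

/-- The Hamiltonian
`∑ᵢ (J_X Xᵢ Xᵢ₊₁ + J_Y Yᵢ Yᵢ₊₁ + h_X Xᵢ + h_Y Yᵢ + h_Z Zᵢ)` with periodic boundary condition. -/
def hamiltonian (N : ℕ) [NeZero N] (JX JY hX hY hZ : ℝ) : Op N :=
  ∑ i : ZMod N,
    ((JX : ℂ) • (site pauliX i * site pauliX (i + 1))
      + (JY : ℂ) • (site pauliY i * site pauliY (i + 1))
      + (hX : ℂ) • site pauliX i + (hY : ℂ) • site pauliY i + (hZ : ℂ) • site pauliZ i)

/-- `A` acts on the set `S` of sites: it is `B ⊗ 1`, with `B` an operator on the sites in `S`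
and `1` the identity on the sites outside `S`. -/
def ActsOn {N : ℕ} (S : Set (ZMod N)) (A : Op N) : Prop :=
  ∃ B : Matrix (S → Fin 2) (S → Fin 2) ℂ, ∀ s t : Config N,
    ((∀ j, j ∉ S → s j = t j) → A s t = B (fun j : S => s j) (fun j : S => t j)) ∧
    (¬ (∀ j, j ∉ S → s j = t j) → A s t = 0)

/-- The `k` consecutive sites `i, i + 1, …, i + k - 1`. -/
def arc {N : ℕ} (i : ZMod N) (k : ℕ) : Set (ZMod N) :=
  {j | ∃ m : ℕ, m < k ∧ j = i + (m : ZMod N)}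

/-- `A` is a `k`-support operator: it acts on `k` consecutive sites. (Whether operators acting
on fewer sites are excluded is immaterial below, as all `l ≤ k` are allowed there.) -/
def IsSupportOperator {N : ℕ} (k : ℕ) (A : Op N) : Prop :=
  ∃ i : ZMod N, ActsOn (arc i k) A

/-- `Q` is a `k`-support quantity: it is a sum of `l`-support operators with `l ≤ k`, and not a
sum of `l`-support operators with `l < k`. -/
def IsSupportQuantity {N : ℕ} (k : ℕ) (Q : Op N) : Prop :=
  Q ∈ Submodule.span ℂ {A : Op N | ∃ l ≤ k, IsSupportOperator l A} ∧
  Q ∉ Submodule.span ℂ {A : Op N | ∃ l < k, IsSupportOperator l A}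

/-- `Q` is a `k`-support conserved quantity of the Hamiltonian `H`. -/
def IsSupportConserved {N : ℕ} [NeZero N] (H : Op N) (k : ℕ) (Q : Op N) : Prop :=
  Commute Q H ∧ IsSupportQuantity k Q

end SpinChain

namespace SpinChain

/-! Expand Q in Pauli strings, `coeff Q T` being the trace of T Q. For each string S, tr([H, S] Q) =
0 is a linear equation between coefficients (`sum_coeff_eq_zero`). Write k = n + 3; the longest
words of Q occupy positions 0, …, n + 2. It suffices that all their coefficients vanish, for then Q
is a sum of operators of smaller support.

The equation of a word of k + 1 letters contains only the two ways of cutting it back to k letters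
(`cuts_eq_zero`). It carries a nonzero coefficient from one site to the next while the word is
consumed from the left. This forces the shape D Z … Z E with D, E in {X, Y} (`middle_eq_Z`,
`ends_inPlane`) and ties the coefficients at neighbouring sites together (`zWord_step`).

The field enters through words of k letters in which an interior Z is replaced by an in-plane defect
F (`defectWord_equation`): the field along the other in-plane axis `F.bar` restores the Z, and the
two cuts give words of k - 1 letters. Moving the defect through the word eliminates these shorter
words (`defect_chain`), while the field terms add up instead of cancelling. If D = F, both ends of
the chain close, since equal letters commute, and k - 2 times the field times the coefficient is
zero. If D = `F.bar`, the leftover word Z … Z E is removed by `zWord_Z_equation`, and the factor is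
k - 1. Translation by one site covers the remaining pairs (D, E). -/

/-- Labels of the one-site Pauli basis. -/
inductive Pauli
  | I | X | Y | Z
  deriving DecidableEq

/-! ### One-site Pauli algebra: products, phases, commutator signs -/

namespace Pauli

instance : Fintype Pauli := ⟨{I, X, Y, Z}, by intro x; cases x <;> decide⟩

/-- The Pauli matrix with a given label. -/
def mat : Pauli → Matrix (Fin 2) (Fin 2) ℂ
  | I => 1
  | X => pauliX
  | Y => pauliY
  | Z => pauliZ

/-- The product of labels: the product of Pauli matrices up to a phase. -/
def mul : Pauli → Pauli → Pauli
  | I, a => a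
  | a, I => a
  | X, X => I
  | Y, Y => I
  | Z, Z => I
  | X, Y => Z
  | Y, X => Z
  | Y, Z => X
  | Z, Y => X
  | Z, X => Y
  | X, Z => Y

instance : Mul Pauli := ⟨mul⟩

/-- The sign of the commutator of two Pauli matrices. -/
def sgn : Pauli → Pauli → ℤ
  | X, Y => 1
  | Y, Z => 1
  | Z, X => 1
  | Y, X => -1
  | Z, Y => -1
  | X, Z => -1
  | _, _ => 0

/-- The sign of the commutator of `a ⊗ b` with `P ⊗ P`. -/
def bondSgn (a b P : Pauli) : ℤ :=
  sgn a P * (if sgn b P = 0 then 1 else 0) + sgn b P * (if sgn a P = 0 then 1 else 0)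

/-- The phase of the product of two Pauli matrices. -/
noncomputable def phase (a b : Pauli) : ℂ :=
  if sgn a b = 0 then 1 else (sgn a b : ℂ) * Complex.I

lemma sum_univ {M : Type*} [AddCommMonoid M] (f : Pauli → M) :
    ∑ P, f P = f I + f X + f Y + f Z := by
  have : (Finset.univ : Finset Pauli) = {I, X, Y, Z} := rfl
  rw [this]
  simp [add_assoc]

lemma mul_comm (a b : Pauli) : a * b = b * a := by
  revert a b; decide

lemma mat_mul (a b : Pauli) : a.mat * b.mat = phase a b • (a * b).mat := by
  cases a <;> cases b <;> change _ = _ • (Pauli.mul _ _).mat <;>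
    ext i j <;> fin_cases i <;> fin_cases j <;>
    simp [mat, Pauli.mul, phase, sgn, pauliX, pauliY, pauliZ, Matrix.mul_apply]

lemma phase_one_left (a : Pauli) : phase I a = 1 := by
  cases a <;> simp [phase, sgn]

lemma phase_one_right (a : Pauli) : phase a I = 1 := by
  cases a <;> simp [phase, sgn]

lemma one_mul' (a : Pauli) : I * a = a := by cases a <;> rfl

lemma phase_sub (a P : Pauli) :
    phase P a - phase a P = -2 * Complex.I * (sgn a P : ℂ) := by
  cases a <;> cases P <;> simp [phase, sgn] <;> ring

/-- `P ⊗ P` fails to commute with `a ⊗ b` exactly when P anticommutes with one of a, b and commutes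
with the other; two anticommutations cancel. -/
lemma phase_mul_sub (a b P : Pauli) :
    phase P b * phase P a - phase a P * phase b P
      = -2 * Complex.I * (bondSgn a b P : ℂ) := by
  cases a <;> cases b <;> cases P <;> simp [phase, sgn, bondSgn] <;> ring

lemma sum_mat_mul_mat (a b c d : Fin 2) :
    ∑ P : Pauli, P.mat a b * P.mat c d = if a = d ∧ b = c then 2 else 0 := by
  rw [sum_univ]
  fin_cases a <;> fin_cases b <;> fin_cases c <;> fin_cases d <;>
    simp [mat, pauliX, pauliY, pauliZ] <;> norm_num

end Pauli

/-! ### Pauli strings and their commutators with the terms of the Hamiltonian -/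

variable {N : ℕ}

/-- The label `P` multiplied onto site `i` of a Pauli string. -/
def mulAt (T : ZMod N → Pauli) (i : ZMod N) (P : Pauli) : ZMod N → Pauli :=
  Function.update T i (T i * P)

lemma mulAt_comm (T : ZMod N → Pauli) {i j : ZMod N} (h : i ≠ j) (P P' : Pauli) :
    mulAt (mulAt T i P) j P' = mulAt (mulAt T j P') i P := by
  unfold mulAt
  rw [Function.update_of_ne h.symm, Function.update_of_ne h, Function.update_comm h]

variable [NeZero N]

lemma tensorOp_mul (A B : ZMod N → Matrix (Fin 2) (Fin 2) ℂ) :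
    tensorOp A * tensorOp B = tensorOp fun j => A j * B j := by
  ext s t
  simp only [tensorOp, Matrix.mul_apply, Matrix.of_apply]
  rw [Finset.prod_univ_sum, Fintype.piFinset_univ]
  exact Finset.sum_congr rfl fun u _ => Finset.prod_mul_distrib.symm

lemma tensorOp_smul (c : ZMod N → ℂ) (A : ZMod N → Matrix (Fin 2) (Fin 2) ℂ) :
    tensorOp (fun j => c j • A j) = (∏ j, c j) • tensorOp A := by
  ext s t
  simp [tensorOp, Finset.prod_mul_distrib]

/-- The Pauli string with given labels. -/
def pauliString (T : ZMod N → Pauli) : Op N := tensorOp fun j => (T j).mat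

lemma site_eq_pauliString (P : Pauli) (i : ZMod N) :
    site P.mat i = pauliString (Function.update (fun _ => Pauli.I) i P) := by
  unfold site pauliString
  congr 1
  funext j
  by_cases h : j = i
  · subst h; simp
  · simp [h, Pauli.mat]

lemma pauliString_mul (S T : ZMod N → Pauli) :
    pauliString S * pauliString T
      = (∏ j, Pauli.phase (S j) (T j)) • pauliString fun j => S j * T j := by
  unfold pauliString
  rw [tensorOp_mul, ← tensorOp_smul]
  congr 1
  funext j
  exact Pauli.mat_mul _ _

lemma site_mul_pauliString (P : Pauli) (i : ZMod N) (T : ZMod N → Pauli) :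
    site P.mat i * pauliString T = Pauli.phase P (T i) • pauliString (mulAt T i P) := by
  rw [site_eq_pauliString, pauliString_mul, Finset.prod_eq_single i]
  · congr 2
    · simp
    · funext j
      by_cases h : j = i
      · subst h; simp [mulAt, Pauli.mul_comm]
      · simp [h, mulAt, Pauli.one_mul']
  · intro j _ h
    simp [h, Pauli.phase_one_left]
  · simp

lemma pauliString_mul_site (P : Pauli) (i : ZMod N) (T : ZMod N → Pauli) :
    pauliString T * site P.mat i = Pauli.phase (T i) P • pauliString (mulAt T i P) := by
  rw [site_eq_pauliString, pauliString_mul, Finset.prod_eq_single i]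
  · congr 2
    · simp
    · funext j
      by_cases h : j = i
      · subst h; simp [mulAt]
      · simp [h, mulAt, Pauli.mul_comm _ Pauli.I, Pauli.one_mul']
  · intro j _ h
    simp [h, Pauli.phase_one_right]
  · simp

lemma site_commutator (P : Pauli) (i : ZMod N) (T : ZMod N → Pauli) :
    site P.mat i * pauliString T - pauliString T * site P.mat i
      = (-2 * Complex.I * (Pauli.sgn (T i) P : ℂ)) • pauliString (mulAt T i P) := by
  rw [site_mul_pauliString, pauliString_mul_site, ← sub_smul, Pauli.phase_sub]

lemma bond_commutator (P : Pauli) {i j : ZMod N} (hij : i ≠ j) (T : ZMod N → Pauli) :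
    site P.mat i * site P.mat j * pauliString T - pauliString T * (site P.mat i * site P.mat j)
      = (-2 * Complex.I * (Pauli.bondSgn (T i) (T j) P : ℂ)) •
        pauliString (mulAt (mulAt T i P) j P) := by
  have h1 : mulAt T j P i = T i := by simp [mulAt, hij]
  have h2 : mulAt T i P j = T j := by simp [mulAt, hij.symm]
  rw [mul_assoc, site_mul_pauliString, Matrix.mul_smul, site_mul_pauliString, ← mul_assoc,
    pauliString_mul_site, Matrix.smul_mul, pauliString_mul_site, h1, h2,
    mulAt_comm T hij.symm, smul_smul, smul_smul, ← sub_smul, Pauli.phase_mul_sub]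

/-! ### Coefficients and the equations imposed by commutation -/

/-- The (unnormalized) coefficient of a Pauli string in an operator. -/
noncomputable def coeff (Q : Op N) (T : ZMod N → Pauli) : ℂ := (pauliString T * Q).trace

/-- The coefficient of the coupling of the Hamiltonian. -/
def coupling (JX JY : ℝ) : Pauli → ℂ
  | .X => JX
  | .Y => JY
  | _ => 0

/-- The components of the field of the Hamiltonian. -/
def field (hX hY hZ : ℝ) : Pauli → ℂ
  | .X => hX
  | .Y => hY
  | .Z => hZ
  | .I => 0

lemma hamiltonian_eq (JX JY hX hY hZ : ℝ) :
    hamiltonian N JX JY hX hY hZ = ∑ i : ZMod N,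
      ((∑ P : Pauli, field hX hY hZ P • site P.mat i) +
        ∑ P : Pauli, coupling JX JY P • (site P.mat i * site P.mat (i + 1))) := by
  unfold hamiltonian
  refine Finset.sum_congr rfl fun i _ => ?_
  simp only [Pauli.sum_univ, field, coupling, Pauli.mat, zero_smul]
  abel

/-- By cyclicity of the trace, tr([H, S] Q) = tr(S [Q, H]) = 0. Expanding [H, S] term by term
produces a common factor -2i, which is divided out. The bound 2 ≤ N makes the two sites of a bond
distinct. -/
lemma sum_coeff_eq_zero (hN : 2 ≤ N) {JX JY hX hY hZ : ℝ} {Q : Op N}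
    (hQ : Commute Q (hamiltonian N JX JY hX hY hZ)) (S : ZMod N → Pauli) :
    ∑ i : ZMod N,
      ((∑ P : Pauli, field hX hY hZ P * (Pauli.sgn (S i) P * coeff Q (mulAt S i P))) +
        ∑ P : Pauli, coupling JX JY P * (Pauli.bondSgn (S i) (S (i + 1)) P *
          coeff Q (mulAt (mulAt S i P) (i + 1) P))) = 0 := by
  have hne : ∀ i : ZMod N, i ≠ i + 1 := by
    intro i h
    have : Fact (1 < N) := ⟨hN⟩
    exact one_ne_zero (left_eq_add.mp h)
  have h0 : ((hamiltonian N JX JY hX hY hZ * pauliString S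
      - pauliString S * hamiltonian N JX JY hX hY hZ) * Q).trace = 0 := by
    rw [Matrix.sub_mul, Matrix.trace_sub, mul_assoc, Matrix.trace_mul_comm, mul_assoc, mul_assoc,
      hQ.eq, sub_self]
  have h1 : hamiltonian N JX JY hX hY hZ * pauliString S
      - pauliString S * hamiltonian N JX JY hX hY hZ = ∑ i : ZMod N,
      ((∑ P : Pauli, field hX hY hZ P •
        (-2 * Complex.I * (Pauli.sgn (S i) P : ℂ)) • pauliString (mulAt S i P)) +
        ∑ P : Pauli, coupling JX JY P • (-2 * Complex.I * (Pauli.bondSgn (S i) (S (i + 1)) P : ℂ)) •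
          pauliString (mulAt (mulAt S i P) (i + 1) P)) := by
    rw [hamiltonian_eq, Finset.sum_mul, Finset.mul_sum, ← Finset.sum_sub_distrib]
    refine Finset.sum_congr rfl fun i _ => ?_
    rw [add_mul, mul_add, Finset.sum_mul, Finset.sum_mul, Finset.mul_sum, Finset.mul_sum,
      add_sub_add_comm, ← Finset.sum_sub_distrib, ← Finset.sum_sub_distrib]
    congr 1
    · refine Finset.sum_congr rfl fun P _ => ?_
      rw [← site_commutator, Matrix.smul_mul, Matrix.mul_smul, smul_sub]
    · refine Finset.sum_congr rfl fun P _ => ?_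
      rw [← bond_commutator P (hne i), Matrix.smul_mul, Matrix.mul_smul, smul_sub]
  rw [h1] at h0
  simp only [Finset.sum_mul, add_mul, Matrix.trace_sum, Matrix.trace_add, Matrix.smul_mul,
    Matrix.trace_smul, smul_eq_mul] at h0
  have h2 : (-2 * Complex.I) ≠ 0 := by simp
  refine (mul_eq_zero.mp ?_).resolve_left h2
  rw [← h0, Finset.mul_sum]
  refine Finset.sum_congr rfl fun i _ => ?_
  rw [mul_add, Finset.mul_sum, Finset.mul_sum]
  congr 1 <;> refine Finset.sum_congr rfl fun P _ => ?_ <;> simp only [coeff] <;> ring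

/-! ### Coefficients and support -/

lemma coeff_eq_sum (Q : Op N) (T : ZMod N → Pauli) :
    coeff Q T = ∑ s : Config N, ∑ t : Config N, (∏ j, (T j).mat (s j) (t j)) * Q t s := by
  simp [coeff, Matrix.trace, Matrix.mul_apply, pauliString, tensorOp]

/-- The trace over site j factors out and a nontrivial Pauli matrix is traceless. In matrix entries:
A is diagonal at j, so X and Y contribute zero diagonal entries, while for Z flipping the spin at j
changes the sign of each summand. -/
lemma coeff_eq_zero_of_actsOn {A : Op N} {U : Set (ZMod N)} (hA : ActsOn U A)
    (T : ZMod N → Pauli) {j : ZMod N} (hj : j ∉ U) (hT : T j ≠ Pauli.I) : coeff A T = 0 := by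
  obtain ⟨B, hB⟩ := hA
  rw [coeff_eq_sum]
  have hoff : ∀ s t : Config N, s j ≠ t j → A t s = 0 := by
    intro s t h
    exact (hB t s).2 fun hall => h (hall j hj).symm
  by_cases hZ : T j = Pauli.Z
  · let e : Config N ≃ Config N := Equiv.piCongrRight fun m =>
      if m = j then Equiv.swap 0 1 else Equiv.refl _
    have hej : ∀ s, e s j = Equiv.swap 0 1 (s j) := by intro s; simp [e]
    have hem : ∀ s m, m ≠ j → e s m = s m := by intro s m hm; simp [e, hm]
    have key : ∀ s t, (∏ m, (T m).mat (e s m) (e t m)) * A (e t) (e s)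
        = - ((∏ m, (T m).mat (s m) (t m)) * A t s) := by
      intro s t
      by_cases hst : s j = t j
      · have h1 : A (e t) (e s) = A t s := by
          by_cases hall : ∀ m, m ∉ U → t m = s m
          · have hall' : ∀ m, m ∉ U → e t m = e s m := by
              intro m hm
              by_cases hmj : m = j
              · subst hmj; rw [hej, hej, hst]
              · rw [hem _ _ hmj, hem _ _ hmj, hall m hm]
            rw [(hB _ _).1 hall, (hB _ _).1 hall']
            congr 1 <;> funext m <;> exact hem _ _ fun h => hj (h ▸ m.2)
          · have hall' : ¬ ∀ m, m ∉ U → e t m = e s m := by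
              intro h'
              refine hall fun m hm => ?_
              by_cases hmj : m = j
              · subst hmj; exact hst.symm
              · rw [← hem t m hmj, ← hem s m hmj, h' m hm]
            rw [(hB _ _).2 hall, (hB _ _).2 hall']
        rw [h1, ← neg_mul]
        congr 1
        rw [← Finset.mul_prod_erase _ _ (Finset.mem_univ j),
          ← Finset.mul_prod_erase _ _ (Finset.mem_univ j), ← neg_mul]
        congr 1
        · rw [hej, hej, hst, hZ]
          generalize t j = a
          fin_cases a <;> simp [Pauli.mat, pauliZ]
        · refine Finset.prod_congr rfl fun m hm => ?_
          rw [hem _ _ (Finset.ne_of_mem_erase hm), hem _ _ (Finset.ne_of_mem_erase hm)]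
      · rw [hoff s t hst, hoff (e s) (e t)]
        · simp
        · rw [hej, hej]; exact fun h => hst ((Equiv.swap _ _).injective h)
    have h2 : ∑ s : Config N, ∑ t : Config N, (∏ m, (T m).mat (s m) (t m)) * A t s
        = - ∑ s : Config N, ∑ t : Config N, (∏ m, (T m).mat (s m) (t m)) * A t s := by
      conv_lhs => rw [← Equiv.sum_comp e]
      rw [← Finset.sum_neg_distrib]
      refine Finset.sum_congr rfl fun s _ => ?_
      rw [← Equiv.sum_comp e, ← Finset.sum_neg_distrib]
      exact Finset.sum_congr rfl fun t _ => key s t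
    exact self_eq_neg.mp h2
  · refine Finset.sum_eq_zero fun s _ => Finset.sum_eq_zero fun t _ => ?_
    by_cases hst : s j = t j
    · rw [Finset.prod_eq_zero (Finset.mem_univ j), zero_mul]
      rw [hst]
      generalize t j = a
      generalize T j = b at hT hZ
      cases b <;> first | exact absurd rfl hT | exact absurd rfl hZ | skip
      all_goals fin_cases a <;> simp [Pauli.mat, pauliX, pauliY]
    · rw [hoff s t hst, mul_zero]

/-- Completeness of the Pauli basis: the one-site identity `sum_mat_mul_mat`, multiplied over all
sites. -/
lemma sum_coeff_smul_pauliString (Q : Op N) :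
    ∑ T : ZMod N → Pauli, coeff Q T • pauliString T = (2 : ℂ) ^ N • Q := by
  ext u v
  rw [Matrix.sum_apply]
  simp only [Matrix.smul_apply, smul_eq_mul, coeff_eq_sum, pauliString, tensorOp, Matrix.of_apply,
    Finset.sum_mul]
  rw [Finset.sum_comm]
  have key : ∀ s t : Config N, ∑ T : ZMod N → Pauli,
      (∏ j, (T j).mat (s j) (t j)) * Q t s * ∏ j, (T j).mat (u j) (v j)
      = if s = v ∧ t = u then 2 ^ N * Q u v else 0 := by
    intro s t
    have h1 : ∀ T : ZMod N → Pauli,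
        (∏ j, (T j).mat (s j) (t j)) * Q t s * ∏ j, (T j).mat (u j) (v j)
        = (∏ j, (T j).mat (s j) (t j) * (T j).mat (u j) (v j)) * Q t s := by
      intro T; rw [Finset.prod_mul_distrib]; ring
    rw [Finset.sum_congr rfl fun T _ => h1 T, ← Finset.sum_mul]
    have h2 := Finset.prod_univ_sum (fun _ : ZMod N => (Finset.univ : Finset Pauli))
      (fun j P => P.mat (s j) (t j) * P.mat (u j) (v j))
    rw [Fintype.piFinset_univ] at h2
    rw [← h2]
    simp only [Pauli.sum_mat_mul_mat]
    split_ifs with h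
    · obtain ⟨rfl, rfl⟩ := h
      simp [ZMod.card]
    · have : ∃ j, ¬ (s j = v j ∧ t j = u j) := by
        by_contra! hcon
        exact h ⟨funext fun j => (hcon j).1, funext fun j => (hcon j).2⟩
      obtain ⟨j, hj⟩ := this
      rw [Finset.prod_eq_zero (Finset.mem_univ j) (if_neg hj), zero_mul]
  rw [Finset.sum_congr rfl fun s _ => Finset.sum_comm]
  simp only [key]
  rw [Finset.sum_eq_single v, Finset.sum_eq_single u]
  · simp
  · intro t _ h; simp [h]
  · simp
  · intro s _ h; simp [h]
  · simp

lemma actsOn_pauliString (T : ZMod N → Pauli) (U : Set (ZMod N))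
    (h : ∀ j, j ∉ U → T j = Pauli.I) : ActsOn U (pauliString T) := by
  classical
  refine ⟨Matrix.of fun s t => ∏ j : U, (T j).mat (s j) (t j), fun s t => ⟨fun hst => ?_,
    fun hst => ?_⟩⟩
  · simp only [pauliString, tensorOp, Matrix.of_apply]
    rw [← Finset.prod_subtype (Finset.univ.filter (· ∈ U)) (by simp)
      (fun j => (T j).mat (s j) (t j))]
    symm
    refine Finset.prod_subset (Finset.subset_univ _) fun j _ hj => ?_
    have hjU : j ∉ U := by simpa using hj
    rw [h j hjU, hst j hjU]
    simp [Pauli.mat]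
  · push Not at hst
    obtain ⟨j, hj, hne⟩ := hst
    simp only [pauliString, tensorOp, Matrix.of_apply]
    rw [Finset.prod_eq_zero (Finset.mem_univ j)]
    rw [h j hj]
    simp [Pauli.mat, hne]

lemma coeff_eq_zero_of_mem_span {k : ℕ} {Q : Op N}
    (hQ : Q ∈ Submodule.span ℂ {A : Op N | ∃ l ≤ k, IsSupportOperator l A})
    (T : ZMod N → Pauli) (hT : ∀ i, ∃ j, j ∉ arc i k ∧ T j ≠ Pauli.I) : coeff Q T = 0 := by
  induction hQ using Submodule.span_induction with
  | mem A hA =>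
    obtain ⟨l, hl, i, hi⟩ := hA
    obtain ⟨j, hj, hTj⟩ := hT i
    refine coeff_eq_zero_of_actsOn hi T (fun hmem => hj ?_) hTj
    obtain ⟨m, hm, rfl⟩ := hmem
    exact ⟨m, hm.trans_le hl, rfl⟩
  | zero => simp [coeff]
  | add A B _ _ hA hB =>
    have : coeff (A + B) T = coeff A T + coeff B T := by simp [coeff, Matrix.mul_add]
    rw [this, hA, hB, add_zero]
  | smul c A _ hA =>
    have : coeff (c • A) T = c * coeff A T := by simp [coeff]
    rw [this, hA, mul_zero]

lemma mem_span_of_coeff_eq_zero {k : ℕ} {Q : Op N}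
    (hQ : ∀ T : ZMod N → Pauli, coeff Q T ≠ 0 →
      ∃ i, ∃ l < k, ∀ j, j ∉ arc i l → T j = Pauli.I) :
    Q ∈ Submodule.span ℂ {A : Op N | ∃ l < k, IsSupportOperator l A} := by
  have h2 : ((2 : ℂ) ^ N) ≠ 0 := pow_ne_zero _ two_ne_zero
  have : Q = ((2 : ℂ) ^ N)⁻¹ • ∑ T : ZMod N → Pauli, coeff Q T • pauliString T := by
    rw [sum_coeff_smul_pauliString, smul_smul, inv_mul_cancel₀ h2, one_smul]
  rw [this]
  refine Submodule.smul_mem _ _ (Submodule.sum_mem _ fun T _ => ?_)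
  by_cases hT : coeff Q T = 0
  · simp [hT]
  · obtain ⟨i, l, hl, h⟩ := hQ T hT
    exact Submodule.smul_mem _ _
      (Submodule.subset_span ⟨l, hl, i, actsOn_pauliString T _ h⟩)

/-! ### Further sign rules; the in-plane labels X and Y -/

namespace Pauli

lemma mul_ne_I {a b : Pauli} : a * b ≠ I ↔ a ≠ b := by
  revert a b; decide

lemma mul_mul_cancel (a b : Pauli) : a * b * b = a := by
  revert a b; decide

lemma ne_of_sgn_ne_zero {a b : Pauli} : sgn a b ≠ 0 → a ≠ b := by
  revert a b; decide

lemma sgn_I_left (a : Pauli) : sgn I a = 0 := by cases a <;> rfl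

lemma bondSgn_self_left (a b : Pauli) : bondSgn a b a = sgn b a := by
  revert a b; decide

lemma bondSgn_self_right (a b : Pauli) : bondSgn a b b = sgn a b := by
  revert a b; decide

lemma bondSgn_I_right (a P : Pauli) : bondSgn a I P = sgn a P := by
  revert a P; decide

lemma bondSgn_I_left (a P : Pauli) : bondSgn I a P = sgn a P := by
  revert a P; decide

/-- The labels `X` and `Y`. -/
def InPlane (P : Pauli) : Prop := P = X ∨ P = Y

instance (P : Pauli) : Decidable P.InPlane := inferInstanceAs (Decidable (_ ∨ _))

/-- The in-plane label other than a given one. -/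
def bar (P : Pauli) : Pauli := Z * P

lemma InPlane.bar {P : Pauli} : P.InPlane → P.bar.InPlane := by
  revert P; decide

lemma bar_bar (P : Pauli) : P.bar.bar = P := by
  revert P; decide

end Pauli

open Pauli Function

/-! ### Words placed on the ring -/

/-- The Pauli string that reads `f 0, f 1, …` from site `i` on. -/
def place (i : ZMod N) (f : ℕ → Pauli) : ZMod N → Pauli := fun j => f (j - i).val

lemma place_add (i : ZMod N) (f : ℕ → Pauli) {m : ℕ} (hm : m < N) :
    place i f (i + m) = f m := by
  simp [place, ZMod.val_natCast_of_lt hm]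

lemma mulAt_place (i : ZMod N) (f : ℕ → Pauli) {m : ℕ} (hm : m < N) (P : Pauli) :
    mulAt (place i f) (i + m) P = place i (update f m (f m * P)) := by
  unfold mulAt
  rw [place_add i f hm]
  funext j
  by_cases h : j = i + m
  · subst h
    rw [update_self, place_add i _ hm, update_self]
  · rw [update_of_ne h]
    unfold place
    rw [update_of_ne]
    intro h'
    apply h
    rw [← h', ZMod.natCast_zmod_val]
    ring

/-- Seen from site i + 1, site i is at position N - 1, hence the condition on `g (N - 1)`. -/
lemma place_succ (i : ZMod N) {f g : ℕ → Pauli} (h0 : f 0 = I) (hN : g (N - 1) = I)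
    (h : ∀ m, m + 1 < N → g m = f (m + 1)) : place i f = place (i + 1) g := by
  funext j
  unfold place
  have hpos : 0 < N := Nat.pos_of_ne_zero (NeZero.ne N)
  rw [← sub_sub]
  generalize j - i = x
  rcases hx : x.val with _ | m
  · have hx0 : x = 0 := (ZMod.val_eq_zero x).mp hx
    have h1 : (x - 1).val = N - 1 := by
      have : x - 1 = ((N - 1 : ℕ) : ZMod N) := by
        rw [Nat.cast_sub (by omega), hx0]; simp
      rw [this, ZMod.val_natCast_of_lt (by omega)]
    rw [h1, h0, hN]
  · have hlt := ZMod.val_lt x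
    have h1 : (x - 1).val = m := by
      have : x - 1 = (m : ZMod N) := by
        rw [← ZMod.natCast_zmod_val x, hx]; push_cast; ring
      rw [this, ZMod.val_natCast_of_lt (by omega)]
    rw [h1, h m (by omega)]

lemma sum_eq_sum_range {M : Type*} [AddCommMonoid M] (i : ZMod N) (G : ZMod N → M) :
    ∑ j, G j = ∑ m ∈ Finset.range N, G (i + m) := by
  rw [← Equiv.sum_comp (Equiv.addLeft i)]
  refine Finset.sum_nbij' ZMod.val (fun m => (m : ZMod N)) ?_ ?_ ?_ ?_ ?_
  · intro a _; simpa using ZMod.val_lt a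
  · simp
  · intro a _; simp
  · intro a ha; exact ZMod.val_natCast_of_lt (by simpa using ha)
  · intro a _; simp

/-! ### The commutation equations for single words -/

/-- The equations that commutation with the Hamiltonian with couplings `J` and field `h` imposes
on the coefficients of an operator. -/
def IsBalanced (J h : Pauli → ℂ) (q : (ZMod N → Pauli) → ℂ) : Prop :=
  ∀ S : ZMod N → Pauli, ∑ i : ZMod N,
    ((∑ P : Pauli, h P * (sgn (S i) P * q (mulAt S i P))) +
      ∑ P : Pauli, J P * (bondSgn (S i) (S (i + 1)) P *
        q (mulAt (mulAt S i P) (i + 1) P))) = 0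

/-- Vanishing on the strings that act on two sites at distance `k`. -/
def VanishesAt (k : ℕ) (q : (ZMod N → Pauli) → ℂ) : Prop :=
  ∀ (T : ZMod N → Pauli) (i : ZMod N), T i ≠ I → T (i + k) ≠ I → q T = 0

/-- The letters of `f` from `0` to `p` are a word whose first and last letters are not `I`. -/
structure IsWord (p : ℕ) (f : ℕ → Pauli) : Prop where
  first : f 0 ≠ I
  last : f p ≠ I
  beyond : ∀ m, p < m → f m = I

/-- The word `f` multiplied by `P` on the letters `m` and `m + 1`. -/
def mulBond (f : ℕ → Pauli) (m : ℕ) (P : Pauli) : ℕ → Pauli :=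
  update (update f m (f m * P)) (m + 1) (f (m + 1) * P)

/-- The word without its first letter, which is multiplied onto the second one. -/
def cutFirst (f : ℕ → Pauli) : ℕ → Pauli := fun m => if m = 0 then f 1 * f 0 else f (m + 1)

/-- The word without its last letter, which is multiplied onto the one before. -/
def cutLast (r : ℕ) (f : ℕ → Pauli) : ℕ → Pauli := mulBond f r (f (r + 1))

section Extraction

variable {n : ℕ} {J h : Pauli → ℂ} {q : (ZMod N → Pauli) → ℂ}

lemma vanishes_place (hv : VanishesAt (n + 3) q) (hN : 2 * (n + 3) ≤ N) (i : ZMod N)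
    {f : ℕ → Pauli} (h0 : f 0 ≠ I) (h1 : f (n + 3) ≠ I) : q (place i f) = 0 := by
  refine hv _ i ?_ ?_
  · have := place_add i f (m := 0) (by omega)
    rw [Nat.cast_zero, add_zero] at this
    rwa [this]
  · rwa [place_add i f (by omega)]

lemma mulBond_of_ne (f : ℕ → Pauli) {m l : ℕ} (P : Pauli) (h1 : l ≠ m) (h2 : l ≠ m + 1) :
    mulBond f m P l = f l := by
  simp [mulBond, h1, h2]

lemma mulBond_left (f : ℕ → Pauli) (m : ℕ) (P : Pauli) : mulBond f m P m = f m * P := by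
  simp [mulBond]

lemma mulBond_right (f : ℕ → Pauli) (m : ℕ) (P : Pauli) :
    mulBond f m P (m + 1) = f (m + 1) * P := by
  simp [mulBond]

/-- Only terms inside the word survive: a bond that sticks out at either end gives a string with
nontrivial letters at distance n + 3, where q vanishes. -/
lemma sum_word_eq_zero (hb : IsBalanced J h q) (hv : VanishesAt (n + 3) q)
    (hN : 2 * (n + 3) ≤ N) {p : ℕ} (hp : p = n + 2 ∨ p = n + 3) (i : ZMod N) {f : ℕ → Pauli}
    (hf : IsWord p f) :
    (∑ m ∈ Finset.range (p + 1), ∑ P, h P * (sgn (f m) P * q (place i (update f m (f m * P))))) +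
      ∑ m ∈ Finset.range p, ∑ P, J P * (bondSgn (f m) (f (m + 1)) P *
        q (place i (mulBond f m P))) = 0 := by
  rw [← hb (place i f), sum_eq_sum_range i, Finset.sum_add_distrib]
  congr 1
  · rw [← Finset.sum_subset (Finset.range_subset_range.mpr (show p + 1 ≤ N by omega))]
    · refine Finset.sum_congr rfl fun m hm => Finset.sum_congr rfl fun P _ => ?_
      have hm' : m < N := by have := Finset.mem_range.mp hm; omega
      rw [place_add i f hm', mulAt_place i f hm']
    · intro m hm hm'
      simp only [Finset.mem_range] at hm hm'
      refine Finset.sum_eq_zero fun P _ => ?_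
      rw [place_add i f hm, hf.beyond m (by omega), sgn_I_left]
      simp
  · rw [← Finset.sum_subset (Finset.range_subset_range.mpr (show p ≤ N by omega))]
    · refine Finset.sum_congr rfl fun m hm => Finset.sum_congr rfl fun P _ => ?_
      have hm' : m + 1 < N := by have := Finset.mem_range.mp hm; omega
      have he : i + (m : ZMod N) + 1 = i + ((m + 1 : ℕ) : ZMod N) := by push_cast; ring
      rw [he, place_add i f (by omega), place_add i f hm', mulAt_place i f (by omega),
        mulAt_place i _ hm', mulBond, update_of_ne (by omega)]
    · intro m hm hm'
      simp only [Finset.mem_range] at hm hm'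
      refine Finset.sum_eq_zero fun P _ => ?_
      by_cases hlast : m + 1 < N
      · have he : i + (m : ZMod N) + 1 = i + ((m + 1 : ℕ) : ZMod N) := by push_cast; ring
        rw [he, place_add i f (by omega), place_add i f hlast, mulAt_place i f (by omega),
          mulAt_place i _ hlast, update_of_ne (by omega), hf.beyond (m + 1) (by omega),
          bondSgn_I_right]
        by_cases hs : sgn (f m) P = 0
        · simp [hs]
        have hmp : m = p := by
          by_contra hne
          exact hs (by rw [hf.beyond m (by omega), sgn_I_left])
        -- The bond overhangs on the right: position 0 is untouched and position n + 3 is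
        -- nontrivial, either as the added letter or as the modified last one.
        rw [vanishes_place hv hN]
        · simp
        · rw [update_of_ne (by omega), update_of_ne (by omega)]
          exact hf.first
        · rcases hp with hp | hp
          · have : n + 3 = m + 1 := by omega
            rw [this, update_self]
            refine mul_ne_I.mpr fun hI => hs ?_
            rw [← hI]; cases f m <;> rfl
          · have : n + 3 = m := by omega
            rw [this, update_of_ne (by omega), update_self]
            exact mul_ne_I.mpr (ne_of_sgn_ne_zero hs)
      -- The bond overhangs on the left, joining the site before the word to its first letter.
      · have hmN : m = N - 1 := by omega
        have he : i + (m : ZMod N) + 1 = i + ((0 : ℕ) : ZMod N) := by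
          rw [hmN, Nat.cast_sub (by omega)]; simp
        rw [he, place_add i f hm, place_add i f (by omega), mulAt_place i f hm,
          mulAt_place i _ (by omega), update_of_ne (by omega), hf.beyond m (by omega),
          bondSgn_I_left]
        by_cases hs : sgn (f 0) P = 0
        · simp [hs]
        have h0 : f 0 * P ≠ I := mul_ne_I.mpr (ne_of_sgn_ne_zero hs)
        rcases hp with hp | hp
        · have : q (place i (update (update f m (I * P)) 0 (f 0 * P))) = 0 := by
            refine hv _ (i + m) ?_ ?_
            · rw [place_add i _ hm, update_of_ne (by omega), update_self]
              refine mul_ne_I.mpr fun hI => hs ?_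
              rw [← hI]; cases f 0 <;> rfl
            · have he' : i + (m : ZMod N) + ((n + 3 : ℕ) : ZMod N)
                  = i + ((n + 2 : ℕ) : ZMod N) := by
                rw [hmN, Nat.cast_sub (by omega)]; push_cast; simp; ring
              rw [he', place_add i _ (by omega), update_of_ne (by omega),
                update_of_ne (by omega), ← hp]
              exact hf.last
          rw [this]; simp
        · rw [vanishes_place hv hN]
          · simp
          · simpa using h0
          · rw [update_of_ne (by omega), update_of_ne (by omega), ← hp]
            exact hf.last

lemma place_cutFirst (hN : 2 * (n + 3) ≤ N) {p : ℕ} (hp : p = n + 2 ∨ p = n + 3) (i : ZMod N)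
    {f : ℕ → Pauli} (hf : IsWord p f) :
    place i (mulBond f 0 (f 0)) = place (i + 1) (cutFirst f) := by
  refine place_succ i ?_ ?_ fun m hm => ?_
  · rw [mulBond_left]; generalize f 0 = a; cases a <;> rfl
  · rw [cutFirst, if_neg (by omega)]
    exact hf.beyond _ (by omega)
  · by_cases h0 : m = 0
    · subst h0; rw [mulBond_right]; rfl
    · rw [mulBond_of_ne _ _ (by omega) (by omega), cutFirst, if_neg h0]

/-- The equation of a word, if among the bond terms only those that shorten the word
contribute. -/
lemma sum_field_add_cuts_eq_zero (hb : IsBalanced J h q) (hv : VanishesAt (n + 3) q)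
    (hN : 2 * (n + 3) ≤ N) {r : ℕ} (hp : r + 1 = n + 2 ∨ r + 1 = n + 3) (i : ZMod N)
    {f : ℕ → Pauli} (hf : IsWord (r + 1) f)
    (hfull : ∀ m P, m ≤ r → J P ≠ 0 → IsWord (r + 1) (mulBond f m P) →
      q (place i (mulBond f m P)) = 0) :
    (∑ m ∈ Finset.range (r + 2), ∑ P,
        h P * (sgn (f m) P * q (place i (update f m (f m * P))))) +
      (J (f 0) * (sgn (f 1) (f 0) * q (place (i + 1) (cutFirst f))) +
      J (f (r + 1)) * (sgn (f r) (f (r + 1)) * q (place i (cutLast r f)))) = 0 := by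
  rw [← sum_word_eq_zero hb hv hN hp i hf, ← place_cutFirst hN hp i hf]
  congr 1
  have key : ∀ m ∈ Finset.range (r + 1), ∀ P : Pauli, J P * (bondSgn (f m) (f (m + 1)) P *
        q (place i (mulBond f m P))) =
      (if m = 0 then if P = f 0 then
        J (f 0) * (sgn (f 1) (f 0) * q (place i (mulBond f 0 (f 0)))) else 0 else 0) +
      (if m = r then if P = f (r + 1) then
        J (f (r + 1)) * (sgn (f r) (f (r + 1)) * q (place i (cutLast r f))) else 0 else 0) := by
    intro m hm P
    have hm' := Finset.mem_range.mp hm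
    by_cases h0 : m = 0 ∧ P = f 0
    · obtain ⟨rfl, rfl⟩ := h0
      rw [if_pos rfl, if_pos rfl, if_neg (by omega), add_zero, bondSgn_self_left]
    by_cases h1 : m = r ∧ P = f (r + 1)
    · obtain ⟨rfl, rfl⟩ := h1
      rw [if_pos rfl, if_pos rfl, if_neg (by omega), zero_add, bondSgn_self_right]
      rfl
    have e0 : (if m = 0 then if P = f 0 then
        J (f 0) * (sgn (f 1) (f 0) * q (place i (mulBond f 0 (f 0)))) else 0 else 0) = 0 := by
      rw [← ite_and, if_neg h0]
    have e1 : (if m = r then if P = f (r + 1) then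
        J (f (r + 1)) * (sgn (f r) (f (r + 1)) * q (place i (cutLast r f))) else 0 else 0)
        = 0 := by
      rw [← ite_and, if_neg h1]
    rw [e0, e1, add_zero]
    -- Away from the two cuts, the bond term leaves both end letters nontrivial, so the length is
    -- unchanged and `hfull` applies.
    by_cases hJ : J P = 0
    · simp [hJ]
    rw [hfull m P (by omega) hJ]
    · simp
    refine ⟨?_, ?_, fun l hl => ?_⟩
    · by_cases hm0 : m = 0
      · subst hm0
        rw [mulBond_left]
        exact mul_ne_I.mpr fun h => h0 ⟨rfl, h.symm⟩
      · rw [mulBond_of_ne _ _ (by omega) (by omega)]; exact hf.first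
    · by_cases hmr : m = r
      · subst hmr
        rw [mulBond_right]
        exact mul_ne_I.mpr fun h => h1 ⟨rfl, h.symm⟩
      · rw [mulBond_of_ne _ _ (by omega) (by omega)]; exact hf.last
    · rw [mulBond_of_ne _ _ (by omega) (by omega)]; exact hf.beyond l hl
  rw [Finset.sum_congr rfl fun m hm => Finset.sum_congr rfl fun P _ => key m hm P]
  simp only [Finset.sum_add_distrib]
  congr 1
  · rw [Finset.sum_eq_single 0]
    · simp
    · intro m _ hm; simp [hm]
    · simp
  · rw [Finset.sum_eq_single r]
    · simp
    · intro m _ hm; simp [hm]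
    · simp

/-- The equation of a word that is longer by one letter than the words in the support of `q`. -/
lemma cuts_eq_zero (hb : IsBalanced J h q) (hv : VanishesAt (n + 3) q)
    (hN : 2 * (n + 3) ≤ N) (i : ZMod N) {f : ℕ → Pauli} (hf : IsWord (n + 3) f) :
    J (f 0) * (sgn (f 1) (f 0) * q (place (i + 1) (cutFirst f))) +
      J (f (n + 3)) * (sgn (f (n + 2)) (f (n + 3)) * q (place i (cutLast (n + 2) f))) = 0 := by
  rw [← sum_field_add_cuts_eq_zero hb hv hN (r := n + 2) (Or.inr rfl) i hf
    fun m P _ _ hw => vanishes_place hv hN i hw.first hw.last, right_eq_add]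
  refine Finset.sum_eq_zero fun m _ => Finset.sum_eq_zero fun P _ => ?_
  by_cases hs : sgn (f m) P = 0
  · simp [hs]
  have hne := mul_ne_I.mpr (ne_of_sgn_ne_zero hs)
  rw [vanishes_place hv hN]
  · simp
  · rcases eq_or_ne 0 m with rfl | hm
    · simpa using hne
    · rw [update_of_ne hm]; exact hf.first
  · rcases eq_or_ne (n + 3) m with rfl | hm
    · simpa using hne
    · rw [update_of_ne hm]; exact hf.last

end Extraction

/-! ### Shape of the longest words -/

/-- The word `D Z … Z E` with last letter at position `p`. -/
def zWord (p : ℕ) (D E : Pauli) : ℕ → Pauli := fun m =>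
  if m = 0 then D else if m < p then Z else if m = p then E else I

lemma isWord_zWord {p : ℕ} (hp : 0 < p) {D E : Pauli} (hD : D ≠ I) (hE : E ≠ I) :
    IsWord p (zWord p D E) where
  first := by simpa [zWord] using hD
  last := by simpa [zWord, hp.ne'] using hE
  beyond m hm := by simp [zWord, show m ≠ 0 by omega, show ¬ m < p by omega, hm.ne']

lemma Pauli.InPlane.ne_I {P : Pauli} : P.InPlane → P ≠ I := by
  revert P; decide

lemma Pauli.InPlane.sgn_mul_ne_zero {a P : Pauli} :
    P.InPlane → a ≠ I → a ≠ P → sgn (a * P) P ≠ 0 := by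
  revert a P; decide

lemma Pauli.InPlane.of_mul_eq_Z {a P : Pauli} : P.InPlane → a * P = Z → a.InPlane := by
  revert a P; decide

section TopWords

variable {n : ℕ} {J h : Pauli → ℂ} {q : (ZMod N → Pauli) → ℂ}

/-- Extend f on the right to a word whose right cut is f. The two cuts balance, so the left cut also
has a nonzero coefficient and a nonzero prefactor; it is the word g, one site further on. -/
lemma exists_next_word (hb : IsBalanced J h q) (hv : VanishesAt (n + 3) q)
    (hJ : ∀ P, J P ≠ 0 ↔ P.InPlane) (hN : 2 * (n + 3) ≤ N) {i : ZMod N} {f : ℕ → Pauli}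
    (hf : IsWord (n + 2) f) (hq : q (place i f) ≠ 0) {P : Pauli} (hP : P.InPlane)
    (hne : f (n + 2) ≠ P) :
    (f 0).InPlane ∧ sgn (f 1) (f 0) ≠ 0 ∧ ∃ g, IsWord (n + 2) g ∧ q (place (i + 1) g) ≠ 0 ∧
      g 0 = f 1 * f 0 ∧ (∀ m, 1 ≤ m → m ≤ n → g m = f (m + 1)) ∧
      g (n + 1) = f (n + 2) * P := by
  set e : ℕ → Pauli := update (update f (n + 2) (f (n + 2) * P)) (n + 3) P with he
  have he0 : e 0 = f 0 := by simp [he]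
  have he1 : e 1 = f 1 := by simp [he]
  have hem : ∀ m, m ≤ n + 1 → e m = f m := by
    intro m hm
    rw [he, update_of_ne (by omega), update_of_ne (by omega)]
  have he2 : e (n + 2) = f (n + 2) * P := by simp [he]
  have he3 : e (n + 3) = P := by simp [he]
  have hew : IsWord (n + 3) e := by
    refine ⟨by rw [he0]; exact hf.first, by rw [he3]; exact hP.ne_I, fun m hm => ?_⟩
    rw [he, update_of_ne (by omega), update_of_ne (by omega)]
    exact hf.beyond m (by omega)
  have hcut : cutLast (n + 2) e = f := by
    funext m
    unfold cutLast
    rcases eq_or_ne m (n + 2) with rfl | h2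
    · rw [mulBond_left, he2, he3, mul_mul_cancel]
    rcases eq_or_ne m (n + 3) with rfl | h3
    · rw [mulBond_right, he3, hf.beyond _ (by omega)]
      cases P <;> rfl
    · rw [mulBond_of_ne _ _ h2 h3, he, update_of_ne h3, update_of_ne h2]
  have heq := cuts_eq_zero hb hv hN i hew
  rw [hcut, he3, he0, he1, he2] at heq
  have hs : sgn (f (n + 2) * P) P ≠ 0 := hP.sgn_mul_ne_zero hf.last hne
  have hright : J P * ((sgn (f (n + 2) * P) P : ℂ) * q (place i f)) ≠ 0 :=
    mul_ne_zero ((hJ P).mpr hP) (mul_ne_zero (Int.cast_ne_zero.mpr hs) hq)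
  have hleft : J (f 0) * ((sgn (f 1) (f 0) : ℂ) * q (place (i + 1) (cutFirst e))) ≠ 0 := by
    intro h0
    rw [h0, zero_add] at heq
    exact hright heq
  have hs1 : sgn (f 1) (f 0) ≠ 0 :=
    Int.cast_ne_zero.mp (left_ne_zero_of_mul (right_ne_zero_of_mul hleft))
  refine ⟨(hJ _).mp (left_ne_zero_of_mul hleft), hs1, cutFirst e, ⟨?_, ?_, ?_⟩,
    right_ne_zero_of_mul (right_ne_zero_of_mul hleft), ?_, ?_, ?_⟩
  · simp only [cutFirst, if_true, he0, he1]
    exact mul_ne_I.mpr (ne_of_sgn_ne_zero hs1)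
  · rw [cutFirst, if_neg (by omega), he3]; exact hP.ne_I
  · intro m hm
    rw [cutFirst, if_neg (by omega)]
    exact hew.beyond _ (by omega)
  · simp only [cutFirst, if_true, he0, he1]
  · intro m h1 hm
    rw [cutFirst, if_neg (by omega), hem _ (by omega)]
  · rw [cutFirst, if_neg (by omega), he2]

lemma exists_inPlane_ne (a : Pauli) : ∃ P : Pauli, P.InPlane ∧ a ≠ P := by
  revert a; decide

/-- The longest words with nonzero coefficient are of the form `D Z … Z E`. -/
lemma middle_eq_Z (hb : IsBalanced J h q) (hv : VanishesAt (n + 3) q)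
    (hJ : ∀ P, J P ≠ 0 ↔ P.InPlane) (hN : 2 * (n + 3) ≤ N) (m : ℕ) (hm : m ≤ n)
    (i : ZMod N) (f : ℕ → Pauli) (hf : IsWord (n + 2) f) (hq : q (place i f) ≠ 0) :
    f (m + 1) = Z := by
  induction m generalizing i f with
  | zero =>
    obtain ⟨P, hP, hne⟩ := exists_inPlane_ne (f (n + 2))
    obtain ⟨h0, hs, g, hg, hgq, hg0, -, -⟩ := exists_next_word hb hv hJ hN hf hq hP hne
    -- A second extension shows that `g 0 = f 1 * f 0` is in-plane too; as `f 0` is in-plane and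
    -- does not commute with `f 1`, only `f 1 = Z` remains.
    obtain ⟨P', hP', hne'⟩ := exists_inPlane_ne (g (n + 2))
    have h1 := (exists_next_word hb hv hJ hN hg hgq hP' hne').1
    rw [hg0] at h1
    revert h0 hs h1
    generalize f (0 + 1) = b
    generalize f 0 = a
    revert a b
    decide
  | succ m ih =>
    obtain ⟨P, hP, hne⟩ := exists_inPlane_ne (f (n + 2))
    obtain ⟨-, -, g, hg, hgq, -, hgm, -⟩ := exists_next_word hb hv hJ hN hf hq hP hne
    rw [← hgm (m + 1) (by omega) (by omega)]
    exact ih (by omega) _ g hg hgq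

/-- In the next word g, the letter `f (n + 2) * P` has become interior, hence equals Z. -/
lemma ends_inPlane (hb : IsBalanced J h q) (hv : VanishesAt (n + 3) q)
    (hJ : ∀ P, J P ≠ 0 ↔ P.InPlane) (hN : 2 * (n + 3) ≤ N)
    {i : ZMod N} {f : ℕ → Pauli} (hf : IsWord (n + 2) f) (hq : q (place i f) ≠ 0) :
    (f 0).InPlane ∧ (f (n + 2)).InPlane := by
  obtain ⟨P, hP, hne⟩ := exists_inPlane_ne (f (n + 2))
  obtain ⟨h0, -, g, hg, hgq, -, -, hgl⟩ := exists_next_word hb hv hJ hN hf hq hP hne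
  refine ⟨h0, ?_⟩
  have h1 := middle_eq_Z hb hv hJ hN n le_rfl _ g hg hgq
  exact hP.of_mul_eq_Z (hgl.symm.trans h1)

lemma eq_zWord (hb : IsBalanced J h q) (hv : VanishesAt (n + 3) q)
    (hJ : ∀ P, J P ≠ 0 ↔ P.InPlane) (hN : 2 * (n + 3) ≤ N)
    {i : ZMod N} {f : ℕ → Pauli} (hf : IsWord (n + 2) f) (hq : q (place i f) ≠ 0) :
    f = zWord (n + 2) (f 0) (f (n + 2)) := by
  funext m
  unfold zWord
  split_ifs with h0 h1 h2
  · rw [h0]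
  · obtain ⟨l, rfl⟩ := Nat.exists_eq_succ_of_ne_zero h0
    exact middle_eq_Z hb hv hJ hN l (by omega) i f hf hq
  · rw [h2]
  · exact hf.beyond m (by omega)

lemma cutFirst_zWord {p : ℕ} (hp : 0 < p) (D E : Pauli) :
    cutFirst (zWord (p + 1) D E) = zWord p D.bar E := by
  funext m
  unfold cutFirst zWord Pauli.bar
  grind

lemma cutLast_zWord {p : ℕ} (hp : 0 < p) (D E : Pauli) :
    cutLast p (zWord (p + 1) D E) = zWord p D E.bar := by
  funext m
  have hE : E * E = I := by cases E <;> rfl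
  unfold cutLast mulBond zWord Pauli.bar
  simp only [update_apply]
  grind

/-- The relation between the coefficients of the longest words at consecutive sites. -/
lemma zWord_step (hb : IsBalanced J h q) (hv : VanishesAt (n + 3) q)
    (hN : 2 * (n + 3) ≤ N) (i : ZMod N) {D E : Pauli} (hD : D.InPlane) (hE : E.InPlane) :
    J D * (sgn Z D * q (place (i + 1) (zWord (n + 2) D.bar E.bar))) +
      J E.bar * (sgn Z E.bar * q (place i (zWord (n + 2) D E))) = 0 := by
  have := cuts_eq_zero hb hv hN i (isWord_zWord (p := n + 3) (by omega) hD.ne_I hE.bar.ne_I)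
  rw [cutFirst_zWord (by omega), cutLast_zWord (by omega), bar_bar] at this
  simpa [zWord] using this

end TopWords

/-! ### Defects and the effect of the in-plane field -/

/-- The word `D Z … Z E` with its letter at position `j` replaced by `F`. -/
def defectWord (p j : ℕ) (F D E : Pauli) : ℕ → Pauli := update (zWord p D E) j F

namespace Pauli

lemma InPlane.not_mul {D P : Pauli} : D.InPlane → P.InPlane → ¬ (D * P).InPlane := by
  revert D P; decide

lemma InPlane.Z_mul_ne {P : Pauli} : P.InPlane → Z * P ≠ Z := by
  revert P; decide

lemma InPlane.ne_Z {P : Pauli} : P.InPlane → P ≠ Z := by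
  revert P; decide

lemma InPlane.eq_bar_of_ne {D F : Pauli} : D.InPlane → F.InPlane → D ≠ F → D = F.bar := by
  revert D F; decide

lemma InPlane.eq_bar_of_mul_eq_Z {F P : Pauli} : F.InPlane → F * P = Z → P = F.bar := by
  revert F P; decide

lemma InPlane.mul_bar {F : Pauli} : F.InPlane → F * F.bar = Z := by
  revert F; decide

lemma InPlane.sgn_Z_ne_zero {P : Pauli} : P.InPlane → sgn Z P ≠ 0 := by
  revert P; decide

lemma InPlane.sgn_Z_bar {F : Pauli} : F.InPlane → sgn Z F.bar = - sgn Z F := by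
  revert F; decide

lemma InPlane.sgn_bar {F : Pauli} : F.InPlane → sgn F F.bar = sgn Z F := by
  revert F; decide

lemma sgn_self (a : Pauli) : sgn a a = 0 := by cases a <;> rfl

lemma not_inPlane_Z : ¬ Z.InPlane := by decide

end Pauli

section Defects

variable {n : ℕ} {J h : Pauli → ℂ} {q : (ZMod N → Pauli) → ℂ}

lemma isWord_update {p m : ℕ} {f : ℕ → Pauli} (hf : IsWord p f) (hm : m ≤ p) {a : Pauli}
    (ha : a ≠ I) : IsWord p (update f m a) := by
  refine ⟨?_, ?_, fun l hl => ?_⟩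
  · rcases eq_or_ne 0 m with rfl | h0
    · simpa using ha
    · rw [update_of_ne h0]; exact hf.first
  · rcases eq_or_ne p m with rfl | h0
    · simpa using ha
    · rw [update_of_ne h0]; exact hf.last
  · rw [update_of_ne (by omega)]; exact hf.beyond l hl

/-- Any other field or bond term that keeps the length gives a word not of the form D Z … Z E, whose
coefficient is zero. -/
lemma defectWord_equation (hb : IsBalanced J h q) (hv : VanishesAt (n + 3) q)
    (hJ : ∀ P, J P ≠ 0 ↔ P.InPlane) (hN : 2 * (n + 3) ≤ N) (i : ZMod N) {j : ℕ}
    (hj1 : 1 ≤ j) (hj : j ≤ n + 1) {F D E : Pauli} (hF : F.InPlane) (hD : D.InPlane)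
    (hE : E.InPlane) :
    h F.bar * (sgn F F.bar * q (place i (zWord (n + 2) D E))) +
      (J D * (sgn (defectWord (n + 2) j F D E 1) D *
        q (place (i + 1) (cutFirst (defectWord (n + 2) j F D E)))) +
      J E * (sgn (defectWord (n + 2) j F D E (n + 1)) E *
        q (place i (cutLast (n + 1) (defectWord (n + 2) j F D E))))) = 0 := by
  set f := defectWord (n + 2) j F D E with hfdef
  have hf : IsWord (n + 2) f :=
    isWord_update (isWord_zWord (by omega) hD.ne_I hE.ne_I) (by omega) hF.ne_I
  have hf0 : f 0 = D := by
    rw [hfdef, defectWord, update_of_ne (by omega)]; simp [zWord]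
  have hfl : f (n + 2) = E := by
    rw [hfdef, defectWord, update_of_ne (by omega)]; simp [zWord]
  have hfj : f j = F := by rw [hfdef, defectWord, update_self]
  have hfZ : ∀ m, m ≠ j → 1 ≤ m → m ≤ n + 1 → f m = Z := by
    intro m h0 h1 h2
    rw [hfdef, defectWord, update_of_ne h0, zWord, if_neg (by omega), if_pos (by omega)]
  have hmid : ∀ g, IsWord (n + 2) g → q (place i g) ≠ 0 → ∀ m, 1 ≤ m → m ≤ n + 1 → g m = Z := by
    intro g hg hgq m h1 h2
    obtain ⟨l, rfl⟩ := Nat.exists_eq_add_of_le' h1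
    exact middle_eq_Z hb hv hJ hN l (by omega) i g hg hgq
  have key := sum_field_add_cuts_eq_zero hb hv hN (r := n + 1) (Or.inl rfl) i hf ?_
  · rw [hf0, hfl] at key
    rw [← key]
    congr 1
    symm
    have hz : update f j (f j * F.bar) = zWord (n + 2) D E := by
      rw [hfj, hF.mul_bar, hfdef, defectWord, update_idem]
      refine update_eq_self_iff.mpr ?_
      rw [zWord, if_neg (by omega), if_pos (by omega)]
    rw [Finset.sum_eq_single j, Finset.sum_eq_single F.bar, hz, hfj]
    · intro P _ hP
      by_cases hs : sgn (f j) P = 0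
      · simp [hs]
      by_cases hq : q (place i (update f j (f j * P))) = 0
      · simp [hq]
      have := hmid _ (isWord_update hf (by omega) (mul_ne_I.mpr (ne_of_sgn_ne_zero hs))) hq j
        hj1 hj
      rw [update_self, hfj] at this
      exact absurd (hF.eq_bar_of_mul_eq_Z this) hP
    · simp
    · intro l hl hlj
      have hl' := Finset.mem_range.mp hl
      refine Finset.sum_eq_zero fun P _ => ?_
      by_cases hs : sgn (f l) P = 0
      · simp [hs]
      by_cases hq : q (place i (update f l (f l * P))) = 0
      · simp [hq]
      have := hmid _ (isWord_update hf (by omega) (mul_ne_I.mpr (ne_of_sgn_ne_zero hs))) hq j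
        hj1 hj
      rw [update_of_ne hlj.symm, hfj] at this
      exact absurd this hF.ne_Z
    · intro hj'
      exact absurd (Finset.mem_range.mpr (by omega)) hj'
  · intro m P hm hJP hw
    have hP := (hJ P).mp hJP
    by_contra hq
    obtain ⟨he0, hel⟩ := ends_inPlane hb hv hJ hN hw hq
    rcases eq_or_ne m 0 with rfl | hm0
    · rw [mulBond_left, hf0] at he0
      exact hD.not_mul hP he0
    rcases eq_or_ne m (n + 1) with rfl | hm1
    · rw [mulBond_right, hfl] at hel
      exact hE.not_mul hP hel
    rcases eq_or_ne m j with rfl | hmj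
    · have := hmid _ hw hq (m + 1) (by omega) (by omega)
      rw [mulBond_right, hfZ (m + 1) (by omega) (by omega) (by omega)] at this
      exact hP.Z_mul_ne this
    · have := hmid _ hw hq m (by omega) (by omega)
      rw [mulBond_left, hfZ m hmj (by omega) (by omega)] at this
      exact hP.Z_mul_ne this

/-- The left cut drops out because there is no ZZ coupling. The field contributes only by turning
the first Z into an in-plane letter, as a longest word must start with one. -/
lemma zWord_Z_equation (hb : IsBalanced J h q) (hv : VanishesAt (n + 3) q)
    (hJ : ∀ P, J P ≠ 0 ↔ P.InPlane) (hN : 2 * (n + 3) ≤ N) (i : ZMod N)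
    {F E : Pauli} (hF : F.InPlane) (hE : E.InPlane) :
    h F.bar * (sgn Z F.bar * q (place i (zWord (n + 2) F E))) +
      h F * (sgn Z F * q (place i (zWord (n + 2) F.bar E))) +
      J E * (sgn Z E * q (place i (zWord (n + 1) Z E.bar))) = 0 := by
  set f := zWord (n + 2) Z E with hfdef
  have hf : IsWord (n + 2) f := isWord_zWord (by omega) (by decide) hE.ne_I
  have hf0 : f 0 = Z := by simp [hfdef, zWord]
  have hfl : f (n + 2) = E := by simp [hfdef, zWord]
  have hfZ : ∀ m, m ≤ n + 1 → f m = Z := by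
    intro m h0
    rw [hfdef, zWord]
    split_ifs <;> first | rfl | omega
  have hJZ : J Z = 0 := by
    by_contra h0
    exact not_inPlane_Z ((hJ Z).mp h0)
  have key := sum_field_add_cuts_eq_zero hb hv hN (r := n + 1) (Or.inl rfl) i hf ?_
  · rw [hf0, hfl, hJZ, zero_mul, zero_add, hfdef, cutLast_zWord (by omega), ← hfdef,
      hfZ (n + 1) le_rfl] at key
    rw [← key]
    congr 1
    symm
    have hu : ∀ a, update f 0 a = zWord (n + 2) a E := by
      intro a
      funext m
      rcases eq_or_ne m 0 with rfl | hm
      · simp [zWord]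
      · rw [update_of_ne hm, hfdef, zWord, zWord, if_neg hm, if_neg hm]
    rw [Finset.sum_eq_single 0]
    · simp only [hf0, hu, Pauli.sum_univ]
      have hI : sgn Z I = 0 := rfl
      have hZ : sgn Z Z = 0 := rfl
      have hX : Z * X = Y := rfl
      have hY : Z * Y = X := rfl
      rcases hF with rfl | rfl <;> simp only [Pauli.bar, hI, hZ, hX, hY] <;> push_cast <;> ring
    · intro l hl hl0
      have hl' := Finset.mem_range.mp hl
      refine Finset.sum_eq_zero fun P _ => ?_
      by_cases hs : sgn (f l) P = 0
      · simp [hs]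
      by_cases hq : q (place i (update f l (f l * P))) = 0
      · simp [hq]
      have := (ends_inPlane hb hv hJ hN
        (isWord_update hf (by omega) (mul_ne_I.mpr (ne_of_sgn_ne_zero hs))) hq).1
      rw [update_of_ne hl0.symm, hf0] at this
      exact absurd this not_inPlane_Z
    · simp
  · intro m P hm hJP hw
    have hP := (hJ P).mp hJP
    by_contra hq
    rcases eq_or_ne m 0 with rfl | hm0
    · have := middle_eq_Z hb hv hJ hN 0 (by omega) i _ hw hq
      rw [mulBond_right, hfZ 1 (by omega)] at this
      exact hP.Z_mul_ne this
    · obtain ⟨l, rfl⟩ := Nat.exists_eq_succ_of_ne_zero hm0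
      have := middle_eq_Z hb hv hJ hN l (by omega) i _ hw hq
      rw [mulBond_left, hfZ (l + 1) (by omega)] at this
      exact hP.Z_mul_ne this

lemma cutFirst_defectWord {p j : ℕ} (hj : 1 ≤ j) (hjp : j < p) (F D E : Pauli) :
    cutFirst (defectWord (p + 1) (j + 1) F D E) = defectWord p j F D.bar E := by
  funext m
  unfold cutFirst defectWord zWord Pauli.bar
  simp only [update_apply]
  grind

lemma cutFirst_defectWord_one {p : ℕ} (_ : 0 < p) {F : Pauli} (hF : F.InPlane) (E : Pauli) :
    cutFirst (defectWord (p + 1) 1 F F.bar E) = zWord p Z E := by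
  funext m
  have := hF.mul_bar
  unfold cutFirst defectWord zWord
  simp only [update_apply]
  grind

lemma cutLast_defectWord {p j : ℕ} (hj : 1 ≤ j) (hjp : j < p) (F D E : Pauli) :
    cutLast p (defectWord (p + 1) j F D E) = defectWord p j F D E.bar := by
  funext m
  have hE : E * E = I := by cases E <;> rfl
  unfold cutLast mulBond defectWord zWord Pauli.bar
  simp only [update_apply]
  grind

lemma iterate_bar_inPlane {F : Pauli} (hF : F.InPlane) (t : ℕ) : (bar^[t] F).InPlane := by
  induction t with
  | zero => exact hF
  | succ t ih => rw [iterate_succ_apply']; exact ih.bar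

/-- The defect moved by `t` sites from the right end of the word. -/
lemma defect_chain (hb : IsBalanced J h q) (hv : VanishesAt (n + 3) q)
    (hJ : ∀ P, J P ≠ 0 ↔ P.InPlane) (hN : 2 * (n + 3) ≤ N) {F : Pauli} (hF : F.InPlane)
    (t j : ℕ) (hj : 1 ≤ j) (htj : t + j = n + 1) (i : ZMod N) {D : Pauli} (hD : D.InPlane) :
    (t + 1) * (h F.bar * (sgn F F.bar * q (place i (zWord (n + 2) D (bar^[t] F))))) +
      J D * (sgn (defectWord (n + 2) j F D (bar^[t] F) 1) D *
        q (place (i + 1) (cutFirst (defectWord (n + 2) j F D (bar^[t] F))))) = 0 := by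
  induction t generalizing j i D with
  | zero =>
    have h1 := defectWord_equation hb hv hJ hN i hj (by omega) hF hD hF (j := j)
    have hjn : j = n + 1 := by omega
    -- The defect sits next to the last letter, also F; they commute, so the right cut is absent and
    -- the chain starts.
    have h2 : sgn (defectWord (n + 2) j F D F (n + 1)) F = 0 := by
      rw [hjn, defectWord, update_self, sgn_self]
    rw [h2] at h1
    simpa using h1
  | succ t ih =>
    have hE := iterate_bar_inPlane hF t
    rw [iterate_succ_apply']
    generalize bar^[t] F = E at hE ih
    have h1 := defectWord_equation hb hv hJ hN i hj (by omega) hF hD hE.bar (j := j)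
    have h2 := ih (j + 1) (by omega) (by omega) (i - 1) hD.bar
    have h3 := zWord_step hb hv hN (i - 1) hD.bar hE
    have hZ1 : defectWord (n + 2) (j + 1) F D.bar E 1 = Z := by
      rw [defectWord, update_of_ne (by omega), zWord, if_neg (by omega), if_pos (by omega)]
    have hZ2 : defectWord (n + 2) j F D E.bar (n + 1) = Z := by
      rw [defectWord, update_of_ne (by omega), zWord, if_neg (by omega), if_pos (by omega)]
    rw [hZ2, cutLast_defectWord hj (by omega), bar_bar] at h1
    rw [hZ1, cutFirst_defectWord hj (by omega), bar_bar, sub_add_cancel] at h2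
    rw [bar_bar, sub_add_cancel] at h3
    have ha : J D.bar * (sgn Z D.bar : ℂ) ≠ 0 :=
      mul_ne_zero ((hJ _).mpr hD.bar) (Int.cast_ne_zero.mpr hD.bar.sgn_Z_ne_zero)
    refine mul_left_cancel₀ ha ?_
    push_cast
    -- The right cut in `h1` and the left cut in `h2` are the same shorter word at site i and are
    -- eliminated; `h3` moves the t + 1 field terms collected so far from site i - 1 to i, where
    -- they join that of `h1`.
    linear_combination (J D.bar * (sgn Z D.bar : ℂ)) * h1
      - (J E.bar * (sgn Z E.bar : ℂ)) * h2
      + (t + 1) * (h F.bar * (sgn F F.bar : ℂ)) * h3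

lemma zWord_bar_bar_eq_zero (hb : IsBalanced J h q) (hv : VanishesAt (n + 3) q)
    (hJ : ∀ P, J P ≠ 0 ↔ P.InPlane) (hN : 2 * (n + 3) ≤ N) {D E : Pauli} (hD : D.InPlane)
    (hE : E.InPlane) (hq : ∀ i, q (place i (zWord (n + 2) D E)) = 0) (i : ZMod N) :
    q (place i (zWord (n + 2) D.bar E.bar)) = 0 := by
  have h1 := zWord_step hb hv hN (i - 1) hD hE
  rw [hq, sub_add_cancel, mul_zero, mul_zero, add_zero] at h1
  have h2 := (mul_eq_zero.mp h1).resolve_left ((hJ D).mpr hD)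
  exact (mul_eq_zero.mp h2).resolve_left (Int.cast_ne_zero.mpr hD.sgn_Z_ne_zero)

/-- With a nonzero in-plane field component, the coefficients of all longest words vanish. -/
theorem longest_word_eq_zero (hb : IsBalanced J h q) (hv : VanishesAt (n + 3) q)
    (hJ : ∀ P, J P ≠ 0 ↔ P.InPlane) (hN : 2 * (n + 3) ≤ N) {F : Pauli} (hF : F.InPlane)
    (hh : h F.bar ≠ 0) (i : ZMod N) {f : ℕ → Pauli} (hf : IsWord (n + 2) f) :
    q (place i f) = 0 := by
  have hE := iterate_bar_inPlane hF n
  have hchain := fun i (D : Pauli) (hD : D.InPlane) =>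
    defect_chain hb hv hJ hN hF n 1 le_rfl rfl i hD
  generalize bar^[n] F = E at hE hchain
  have hone : ∀ D, defectWord (n + 2) 1 F D E 1 = F := fun D => by
    rw [defectWord, update_self]
  have hs : (sgn Z F : ℂ) ≠ 0 := Int.cast_ne_zero.mpr hF.sgn_Z_ne_zero
  -- With first letter F the defect at position 1 commutes with it, so the left cut vanishes and
  -- only n + 1 equal field terms remain.
  have hFE : ∀ i, q (place i (zWord (n + 2) F E)) = 0 := by
    intro i
    have h1 := hchain i F hF
    rw [hone, sgn_self, hF.sgn_bar] at h1
    have h2 : ((n : ℂ) + 1) ≠ 0 := by exact_mod_cast Nat.succ_ne_zero n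
    simpa [h2, hh, hs] using h1
  have hbb := zWord_bar_bar_eq_zero hb hv hJ hN hF hE hFE
  have hFE' : ∀ i, q (place i (zWord (n + 2) F E.bar)) = 0 := by
    intro i
    have h1 := hchain (i - 1) F.bar hF.bar
    rw [hone, cutFirst_defectWord_one (by omega) hF, sub_add_cancel] at h1
    have h2 := zWord_Z_equation hb hv hJ hN i hF hE.bar
    rw [hbb, bar_bar] at h2
    have h3 := zWord_step hb hv hN (i - 1) hF.bar hE
    rw [bar_bar, sub_add_cancel] at h3
    rw [hF.sgn_Z_bar] at h2 h3
    rw [hF.sgn_bar] at h1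
    push_cast at h2 h3
    -- The factor n + 2 counts the n + 1 field terms of the chain and one more from the equation of
    -- the word Z … Z `E.bar`, through which the leftover Z … Z E is eliminated.
    have h4 : ((n : ℂ) + 2) * (J F.bar * h F.bar * sgn Z F * sgn Z F) ≠ 0 := by
      have h5 : ((n : ℂ) + 2) ≠ 0 := by exact_mod_cast Nat.succ_ne_zero (n + 1)
      exact mul_ne_zero h5 (mul_ne_zero (mul_ne_zero (mul_ne_zero ((hJ _).mpr hF.bar) hh) hs) hs)
    refine (mul_eq_zero.mp ?_).resolve_left h4
    linear_combination (J E.bar * (sgn Z E.bar : ℂ)) * h1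
      - (J F.bar * (sgn Z F : ℂ)) * h2
      - (n + 1) * (h F.bar * (sgn Z F : ℂ)) * h3
  have hbb' := zWord_bar_bar_eq_zero hb hv hJ hN hF hE.bar hFE'
  rw [bar_bar] at hbb'
  by_contra hq
  obtain ⟨h0, hl⟩ := ends_inPlane hb hv hJ hN hf hq
  rw [eq_zWord hb hv hJ hN hf hq] at hq
  by_cases hD : f 0 = F <;> by_cases hE' : f (n + 2) = E
  · rw [hD, hE'] at hq; exact hq (hFE i)
  · rw [hD, hl.eq_bar_of_ne hE hE'] at hq; exact hq (hFE' i)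
  · rw [h0.eq_bar_of_ne hF hD, hE'] at hq; exact hq (hbb' i)
  · rw [h0.eq_bar_of_ne hF hD, hl.eq_bar_of_ne hE hE'] at hq; exact hq (hbb i)

end Defects

/-! ### From support conditions to words, and the conclusion -/

/-- If both sites were in the arc, their offsets m, l < k would satisfy m + k ≡ l mod N; both sides
are below 2k ≤ N, so m + k = l, which is absurd. -/
lemma not_mem_arc_or {k : ℕ} (hN : 2 * k ≤ N) (i a : ZMod N) :
    i ∉ arc a k ∨ i + k ∉ arc a k := by
  by_contra! hcon
  obtain ⟨⟨m, hm, h1⟩, ⟨l, hl, h2⟩⟩ := hcon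
  have h3 : ((m + k : ℕ) : ZMod N) = (l : ZMod N) := by
    rw [h1, add_assoc] at h2
    push_cast
    exact add_left_cancel h2
  rw [ZMod.natCast_eq_natCast_iff', Nat.mod_eq_of_lt (by omega), Nat.mod_eq_of_lt (by omega)] at h3
  omega

lemma vanishesAt_coeff {k : ℕ} (hN : 2 * k ≤ N) {Q : Op N}
    (hQ : Q ∈ Submodule.span ℂ {A : Op N | ∃ l ≤ k, IsSupportOperator l A}) :
    VanishesAt k (coeff Q) := by
  intro T i h0 hk
  refine coeff_eq_zero_of_mem_span hQ T fun a => ?_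
  rcases not_mem_arc_or hN i a with h | h
  · exact ⟨_, h, h0⟩
  · exact ⟨_, h, hk⟩

lemma place_self (i : ZMod N) (T : ZMod N → Pauli) {p : ℕ} (hp : p < N)
    (hT : ∀ j, j ∉ arc i (p + 1) → T j = I) :
    T = place i fun m => if m ≤ p then T (i + m) else I := by
  funext j
  simp only [place]
  split_ifs with h
  · rw [ZMod.natCast_zmod_val]; congr 1; ring
  · refine hT j fun ⟨m, hm, hj⟩ => h ?_
    rw [hj, add_sub_cancel_left, ZMod.val_natCast_of_lt (by omega)]
    omega

end SpinChain

open SpinChain in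
theorem lemma1 (N : ℕ) [NeZero N] (JX JY hX hY hZ : ℝ) (hJX : JX ≠ 0) (hJY : JY ≠ 0)
    (hfield : hX ≠ 0 ∨ hY ≠ 0) (k : ℕ) (hk : 3 ≤ k) (hkN : (k : ℝ) ≤ (N : ℝ) / 2) :
    ¬ ∃ Q : SpinChain.Op N,
      SpinChain.IsSupportConserved (SpinChain.hamiltonian N JX JY hX hY hZ) k Q := by
  rintro ⟨Q, hcomm, hspan, hnot⟩
  obtain ⟨n, rfl⟩ := Nat.exists_eq_add_of_le' hk
  have hN : 2 * (n + 3) ≤ N := by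
    have : (2 * (n + 3 : ℕ) : ℝ) ≤ N := by linarith
    exact_mod_cast this
  have hb : IsBalanced (coupling JX JY) (field hX hY hZ) (coeff Q) :=
    sum_coeff_eq_zero (by omega) hcomm
  have hv := vanishesAt_coeff hN hspan
  have hJ : ∀ P, coupling JX JY P ≠ 0 ↔ P.InPlane := by
    intro P
    cases P <;> simp [coupling, Pauli.InPlane, hJX, hJY]
  -- The defect letter is the in-plane axis other than that of the nonzero field component.
  obtain ⟨F, hF, hh⟩ : ∃ F : Pauli, F.InPlane ∧ field hX hY hZ F.bar ≠ 0 := by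
    rcases hfield with h | h
    · exact ⟨.Y, Or.inr rfl, Complex.ofReal_ne_zero.mpr h⟩
    · exact ⟨.X, Or.inl rfl, Complex.ofReal_ne_zero.mpr h⟩
  refine hnot (mem_span_of_coeff_eq_zero fun T hT => ?_)
  obtain ⟨i, hi⟩ : ∃ i, ∀ j, j ∉ arc i (n + 3) → T j = Pauli.I := by
    by_contra! hcon
    exact hT (coeff_eq_zero_of_mem_span hspan T hcon)
  -- If an end letter of the arc is trivial, T fits into n + 2 sites; otherwise it is a longest
  -- word, whose coefficient vanishes.
  by_cases h0 : T i = Pauli.I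
  · refine ⟨i + 1, n + 2, by omega, fun j hj => ?_⟩
    by_contra hne
    obtain ⟨m, hm, rfl⟩ : j ∈ arc i (n + 3) := by
      by_contra h
      exact hne (hi j h)
    rcases m with _ | m
    · exact hne (by simpa using h0)
    · exact hj ⟨m, by omega, by push_cast; ring⟩
  by_cases h1 : T (i + (n + 2 : ℕ)) = Pauli.I
  · refine ⟨i, n + 2, by omega, fun j hj => ?_⟩
    by_contra hne
    obtain ⟨m, hm, rfl⟩ : j ∈ arc i (n + 3) := by
      by_contra h
      exact hne (hi j h)
    rcases eq_or_ne m (n + 2) with rfl | hm'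
    · exact hne h1
    · exact hj ⟨m, by omega, rfl⟩
  · refine absurd ?_ hT
    rw [place_self i T (p := n + 2) (by omega) hi]
    exact longest_word_eq_zero hb hv hJ hN hF hh i
      ⟨by simpa using h0, by simpa using h1, fun m hm => if_neg (by omega)⟩
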